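/- Let $\Gamma$ be a groupoid (a small category in which every morphism is invertible) with set of objects $\Gamma_0$; identify $e\in\Gamma_0$ with its identity morphism, write $d(\gamma)$ and $r(\gamma)$ for the source and target of a morphism $\gamma$, so that $\gamma\delta$ is defined exactly when $d(\gamma)=r(\delta)$. Let $R\neq 0$ be an associative, not necessarily unital, ring that is $\Gamma$-graded and object unital: $R=\bigoplus_{\gamma\in\Gamma}R_\gamma$ for additive subgroups $R_\gamma$ with $R_\gamma R_\delta\subseteq R_{\gamma\delta}$ if $\gamma\delta$ is defined and $R_\gamma R_\delta=0$ otherwise, and for every $e\in\Gamma_0$ there is $1_e\in R_e$ such that $1_{r(\gamma)}a=a=a1_{d(\gamma)}$ for all $\gamma\in\Gamma$ and $a\in R_\gamma$. A $\Gamma$-graded right $R$-module is a right $R$-module $M$ with $MR=M$ and $M=\bigoplus_{\gamma\in\Gamma}M_\gamma$ for additive subgroups $M_\gamma$ such that $M_\gamma R_\delta\subseteq M_{\gamma\delta}$ if $\gamma\delta$ is defined and $M_\gamma R_\delta=0$ otherwise. A family $(x_i)_{i\in I}$ with $x_i\in M_{\gamma_i}$, $\gamma_i\in\Gamma$, is a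 pseudo-basis of $M$ if it generates $M$ as an $R$-module and the only finitely supported family $(a_i)_{i\in I}$ with $a_i\in 1_{d(\gamma_i)}R$ and $\sum_i x_ia_i=0$ is the zero family; $M$ is pseudo-free if it has a pseudo-basis. Call $R$ a pfm ring if every $\Gamma$-graded right $R$-module is pseudo-free. Say that $R$ has invariant pseudo-basis number (IPBN) if any two pseudo-bases $(x_i)_{i\in I}$, $(y_j)_{j\in J}$ of the same finitely generated $\Gamma$-graded right $R$-module, where $x_i\in M_{\gamma_i}$, $y_j\in M_{\delta_j}$ and $1_{d(\gamma_i)}\neq0$, $1_{d(\delta_j)}\neq 0$ for all $i,j$, satisfy $|I|=|J|$. Call $R$ a graded division ring if $R\ne0$ and for all $\gamma\in\Gamma$ and $0\neq a\in R_\gamma$ there is $b\in R_{\gamma^{-1}}$ with $ab=1_{r(\gamma)}$ and $ba=1_{d(\gamma)}$. Then $R$ is a graded division ring if and only if $R$ is a pfm ring that has IPBN. -/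

import Mathlib

open CategoryTheory

universe u v₁ v₂ w

/-- The set of morphisms of a small groupoid `Γ`. -/
abbrev GrpdMor (Γ : Type v₁) [Groupoid.{v₂} Γ] : Type (max v₁ v₂) := Σ e f : Γ, (e ⟶ f)

namespace GrpdMor

variable {Γ : Type v₁} [Groupoid.{v₂} Γ]

/-- The source `d(γ)` of a morphism `γ`. -/
abbrev d (γ : GrpdMor Γ) : Γ := γ.1

/-- The target `r(γ)` of a morphism `γ`. -/
abbrev r (γ : GrpdMor Γ) : Γ := γ.2.1

/-- The identity morphism of the object `e`. -/
abbrev idMor (e : Γ) : GrpdMor Γ := ⟨e, e, 𝟙 e⟩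

/-- The inverse morphism `γ⁻¹`. -/
abbrev inv (γ : GrpdMor Γ) : GrpdMor Γ := ⟨γ.2.1, γ.1, Groupoid.inv γ.2.2⟩

end GrpdMor

/-- An object unital `Γ`-grading on the (associative, not necessarily unital) ring `R`.
A morphism `γ : f ⟶ g` has `d(γ) = f` and `r(γ) = g`, and the groupoid product `γδ`, defined when
`d(γ) = r(δ)`, is `δ ≫ γ`. -/
structure GroupoidGrading (Γ : Type v₁) [Groupoid.{v₂} Γ] (R : Type u) [NonUnitalRing R] where
  /-- The homogeneous component `R_γ`. -/
  comp : GrpdMor Γ → AddSubgroup R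
  /-- `R` is the direct sum of the components. -/
  internal : @DirectSum.IsInternal (GrpdMor Γ) R (AddSubgroup R) (Classical.decEq _) _ _ _ comp
  /-- `R_γ R_δ ⊆ R_{γδ}` when `γδ` is defined. -/
  mul_mem : ∀ {e f g : Γ} (γ : f ⟶ g) (δ : e ⟶ f) (a b : R),
    a ∈ comp ⟨f, g, γ⟩ → b ∈ comp ⟨e, f, δ⟩ → a * b ∈ comp ⟨e, g, δ ≫ γ⟩
  /-- `R_γ R_δ = 0` when `γδ` is not defined. -/
  mul_eq_zero : ∀ (γ δ : GrpdMor Γ) (a b : R), γ.d ≠ δ.r → a ∈ comp γ → b ∈ comp δ → a * b = 0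
  /-- The element `1_e`. -/
  one : Γ → R
  one_mem : ∀ e : Γ, one e ∈ comp (GrpdMor.idMor e)
  one_mul : ∀ (γ : GrpdMor Γ) (a : R), a ∈ comp γ → one γ.r * a = a
  mul_one : ∀ (γ : GrpdMor Γ) (a : R), a ∈ comp γ → a * one γ.d = a

/-- A right module structure over a not necessarily unital ring: a biadditive associative action,
`act m a` being `m · a`. -/
class RightModule (R : Type u) (M : Type w) [NonUnitalRing R] [AddCommGroup M] where
  act : M →+ R →+ M
  act_mul : ∀ (m : M) (a b : R), act m (a * b) = act (act m a) b

namespace RightModule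

variable (R : Type u) {M : Type w} [NonUnitalRing R] [AddCommGroup M] [RightModule R M]

/-- The set `S` generates `M` as a right `R`-module: the only submodule containing `S` is `M`. -/
def Generates (S : Set M) : Prop :=
  ∀ N : AddSubgroup M, (∀ m ∈ N, ∀ a : R, act m a ∈ N) → S ⊆ N → N = ⊤

variable (M) in
/-- `M` is a finitely generated right `R`-module. -/
def IsFG : Prop := ∃ S : Set M, S.Finite ∧ Generates R S

end RightModule

namespace GroupoidGrading

variable {Γ : Type v₁} [Groupoid.{v₂} Γ] {R : Type u} [NonUnitalRing R]

/-- The graded right ideal `1_e R`. -/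
def oneMulIdeal (A : GroupoidGrading Γ R) (e : Γ) : AddSubgroup R :=
  (AddMonoidHom.mulLeft (A.one e)).range

/-- `R` is a graded division ring: `R ≠ 0` and each nonzero `a ∈ R_γ` has an inverse
`b ∈ R_{γ⁻¹}`, that is, `ab = 1_{r(γ)}` and `ba = 1_{d(γ)}`. -/
def IsGrDivisionRing (A : GroupoidGrading Γ R) : Prop :=
  Nontrivial R ∧ ∀ (γ : GrpdMor Γ), ∀ a ∈ A.comp γ, a ≠ 0 →
    ∃ b ∈ A.comp γ.inv, a * b = A.one γ.r ∧ b * a = A.one γ.d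

end GroupoidGrading

/-- A `Γ`-grading on the right `R`-module `M`, which is moreover required to be unital
(`M R = M`). -/
structure ModuleGrading {Γ : Type v₁} [Groupoid.{v₂} Γ] {R : Type u} [NonUnitalRing R]
    (A : GroupoidGrading Γ R) (M : Type w) [AddCommGroup M] [RightModule R M] where
  /-- The homogeneous component `M_γ`. -/
  comp : GrpdMor Γ → AddSubgroup M
  /-- `M` is the direct sum of the components. -/
  internal : @DirectSum.IsInternal (GrpdMor Γ) M (AddSubgroup M) (Classical.decEq _) _ _ _ comp
  /-- `M_γ R_δ ⊆ M_{γδ}` when `γδ` is defined. -/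
  act_mem : ∀ {e f g : Γ} (γ : f ⟶ g) (δ : e ⟶ f) (m : M) (a : R),
    m ∈ comp ⟨f, g, γ⟩ → a ∈ A.comp ⟨e, f, δ⟩ → RightModule.act m a ∈ comp ⟨e, g, δ ≫ γ⟩
  /-- `M_γ R_δ = 0` when `γδ` is not defined. -/
  act_eq_zero : ∀ (γ δ : GrpdMor Γ) (m : M) (a : R), γ.d ≠ δ.r → m ∈ comp γ → a ∈ A.comp δ →
    RightModule.act m a = 0
  /-- Every element of `M` is a finite sum of elements `m · a`. -/
  unital : AddSubgroup.closure {y : M | ∃ (m : M) (a : R), y = RightModule.act m a} = ⊤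

namespace ModuleGrading

variable {Γ : Type v₁} [Groupoid.{v₂} Γ] {R : Type u} [NonUnitalRing R]
  {A : GroupoidGrading Γ R} {M : Type w} [AddCommGroup M] [RightModule R M]

/-- The family `(x_i)`, with `x_i ∈ M_{γ_i}`, is a pseudo-basis of `M`: it generates `M`, and
the only finitely supported `(a_i)` with `a_i ∈ 1_{d(γ_i)} R` and `∑ x_i a_i = 0` is zero. -/
structure IsPseudoBasis (B : ModuleGrading A M) {I : Type*} (γ : I → GrpdMor Γ) (x : I → M) :
    Prop where
  mem : ∀ i, x i ∈ B.comp (γ i)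
  indep : ∀ a : I →₀ R, (∀ i, a i ∈ A.oneMulIdeal (γ i).d) →
    (a.sum fun i r => RightModule.act (x i) r) = 0 → a = 0
  generates : RightModule.Generates R (Set.range x)

/-- `M` is pseudo-free: it has a pseudo-basis. -/
def IsPseudoFree (B : ModuleGrading A M) : Prop :=
  ∃ (I : Type w) (γ : I → GrpdMor Γ) (x : I → M), B.IsPseudoBasis γ x

end ModuleGrading

namespace GroupoidGrading

variable {Γ : Type v₁} [Groupoid.{v₂} Γ] {R : Type u} [NonUnitalRing R]

/-- `R` is a pfm ring: every `Γ`-graded (unital) right `R`-module is pseudo-free. The modules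
range over an arbitrary universe that is at least as large as that of `R`. -/
def IsPfm (A : GroupoidGrading Γ R) : Prop :=
  ∀ (M : Type (max u w)) [AddCommGroup M] [RightModule R M] (B : ModuleGrading A M),
    B.IsPseudoFree

/-- `R` has invariant pseudo-basis number: any two pseudo-bases of a finitely generated
`Γ`-graded right `R`-module have the same number of elements. The degrees `γ_i` of the
pseudo-bases compared are such that `1_{d(γ_i)} ≠ 0`; equivalently, zero elements of `M`, which
could be inserted at will in degrees `γ` with `1_{d(γ)} = 0`, are not counted. -/
def HasIPBN (A : GroupoidGrading Γ R) : Prop :=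
  ∀ (M : Type (max u w)) [AddCommGroup M] [RightModule R M] (B : ModuleGrading A M),
    RightModule.IsFG R M →
    ∀ (I J : Type (max u w)) (γ : I → GrpdMor Γ) (x : I → M) (δ : J → GrpdMor Γ) (y : J → M),
      B.IsPseudoBasis γ x → B.IsPseudoBasis δ y →
      (∀ i, A.one (γ i).d ≠ 0) → (∀ j, A.one (δ j).d ≠ 0) →
      Cardinal.mk I = Cardinal.mk J

end GroupoidGrading

/-! Over a graded division ring, homogeneous elements of a graded module behave like vectors. If `x`
lies in the span of `S` and `y` but not of `S`, projecting the relation to the degree of `x` makes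
the coefficient of `y` homogeneous, hence invertible, and `y` can be solved for (`span_exchange`).
Zorn's lemma then gives a maximal independent homogeneous set, which spans and is a pseudo-basis
(`isPseudoFree_of_isGrDivisionRing`). Steinitz replacement (`card_le_card_of_spanIndep`) gives IPBN,
since finite generation forces pseudo-bases without trivial members to be finite.

Conversely, let `a ≠ 0` be homogeneous of degree `γ`, and put `P = 1_{r(γ)}R`, which has a
one-element pseudo-basis, and `N = aR ⊆ P`. If `N ≠ P`, then `N` and `P/N` are both nonzero and have
pseudo-bases, which combine to one of `P` with at least two nontrivial members, against IPBN. So `aR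
= 1_{r(γ)}R` and `a` has a right inverse (`exists_mul_eq_one`). As this holds for every nonzero
homogeneous element, right inverses are two-sided. -/

/-! ### Projections of an internal direct sum. -/

namespace DirectSum.IsInternal

variable {ι : Type*} {M : Type*} [AddCommGroup M] {comp : ι → AddSubgroup M}

/-- The projection of an internal direct sum onto a summand, as an endomorphism. -/
noncomputable def proj
    (h : @DirectSum.IsInternal ι M (AddSubgroup M) (Classical.decEq _) _ _ _ comp) (i : ι) :
    M →+ M :=
  letI := Classical.decEq ι
  (comp i).subtype.comp ((DFinsupp.evalAddMonoidHom i).comp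
    (AddEquiv.ofBijective (DirectSum.coeAddMonoidHom comp) h).symm.toAddMonoidHom)

variable (h : @DirectSum.IsInternal ι M (AddSubgroup M) (Classical.decEq _) _ _ _ comp)

theorem proj_mem (i : ι) (m : M) : h.proj i m ∈ comp i := by
  let := Classical.decEq ι
  exact ((AddEquiv.ofBijective (DirectSum.coeAddMonoidHom comp) h).symm m i).2

theorem symm_apply_of_mem {i : ι} {m : M} (hm : m ∈ comp i) :
    letI := Classical.decEq ι
    (AddEquiv.ofBijective (DirectSum.coeAddMonoidHom comp) h).symm m =
      DirectSum.of (fun i => comp i) i ⟨m, hm⟩ := by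
  let := Classical.decEq ι
  refine (AddEquiv.symm_apply_eq _).2 ?_
  exact (DirectSum.coeAddMonoidHom_of comp i ⟨m, hm⟩).symm

theorem proj_of_mem {i : ι} {m : M} (hm : m ∈ comp i) : h.proj i m = m := by
  let := Classical.decEq ι
  have := h.symm_apply_of_mem hm
  simp only [proj, AddMonoidHom.comp_apply]
  erw [this]
  erw [DirectSum.of_eq_same]
  rfl

theorem proj_of_mem_ne {i j : ι} {m : M} (hm : m ∈ comp i) (hij : i ≠ j) : h.proj j m = 0 := by
  let := Classical.decEq ι
  have := h.symm_apply_of_mem hm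
  simp only [proj, AddMonoidHom.comp_apply]
  erw [this]
  erw [DirectSum.of_eq_of_ne _ _ _ hij.symm]
  rfl

theorem mem_of_forall_proj_mem {N : AddSubgroup M} {m : M} (hN : ∀ i, h.proj i m ∈ N) :
    m ∈ N := by
  classical
  let := Classical.decEq ι
  have key : m = DirectSum.coeAddMonoidHom comp
      ((AddEquiv.ofBijective (DirectSum.coeAddMonoidHom comp) h).symm m) :=
    ((AddEquiv.ofBijective (DirectSum.coeAddMonoidHom comp) h).apply_symm_apply m).symm
  rw [key, DirectSum.coeAddMonoidHom_eq_dfinsuppSum]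
  exact AddSubgroup.sum_mem _ fun i _ => hN i

theorem eq_zero_of_forall_proj {m : M} (hm : ∀ i, h.proj i m = 0) : m = 0 := by
  have := h.mem_of_forall_proj_mem (N := ⊥) (m := m) (by simpa using hm)
  simpa using this

theorem eq_top_of_forall_le
    (h : @DirectSum.IsInternal ι M (AddSubgroup M) (Classical.decEq _) _ _ _ comp)
    {N : AddSubgroup M} (hN : ∀ i, comp i ≤ N) : N = ⊤ :=
  eq_top_iff.2 fun _ _ => h.mem_of_forall_proj_mem fun i => hN i (h.proj_mem i _)

theorem addMonoidHom_ext
    (h : @DirectSum.IsInternal ι M (AddSubgroup M) (Classical.decEq _) _ _ _ comp)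
    {P : Type*} [AddCommGroup P] {f g : M →+ P}
    (hfg : ∀ i, ∀ m ∈ comp i, f m = g m) : f = g := by
  have : f.eqLocus g = ⊤ := h.eq_top_of_forall_le fun i m hm => hfg i m hm
  ext m
  exact (this ▸ AddSubgroup.mem_top m : m ∈ f.eqLocus g)

/-- The maps `p i` read off the components of a sum, giving injectivity; `htop` gives surjectivity.
The gradings of regular, sub- and quotient modules are built this way. -/
theorem of_proj (p : ι → M →+ M) (hp : ∀ i, ∀ m ∈ comp i, p i m = m)
    (hp' : ∀ i j, ∀ m ∈ comp i, i ≠ j → p j m = 0)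
    (htop : ∀ N : AddSubgroup M, (∀ i, comp i ≤ N) → N = ⊤) :
    @DirectSum.IsInternal ι M (AddSubgroup M) (Classical.decEq _) _ _ _ comp := by
  let := Classical.decEq ι
  have key : ∀ (i : ι) (f : DirectSum ι fun i => comp i),
      p i (DirectSum.coeAddMonoidHom comp f) = f i := by
    intro i f
    induction f using DirectSum.induction_on with
    | zero => simp
    | add f g hf hg => simp [hf, hg]
    | of j x =>
      rw [DirectSum.coeAddMonoidHom_of]
      by_cases hij : j = i
      · subst hij
        rw [hp _ _ x.2, DirectSum.of_eq_same]
      · rw [hp' _ _ _ x.2 hij, DirectSum.of_eq_of_ne _ _ _ (Ne.symm hij)]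
        rfl
  constructor
  · intro f g hfg
    ext i
    rw [← key, ← key, hfg]
  · have := htop (DirectSum.coeAddMonoidHom comp).range fun i m hm =>
      ⟨DirectSum.of (fun i => comp i) i ⟨m, hm⟩, by simp⟩
    exact AddMonoidHom.range_eq_top.1 this

end DirectSum.IsInternal

/-! ### Spans over a ring without unit. -/

namespace RightModule

variable {R : Type u} {M : Type w} [NonUnitalRing R] [AddCommGroup M] [RightModule R M]

variable (R) in
/-- The additive subgroup of all finite sums of elements `s · a` with `s ∈ S`. -/
def span (S : Set M) : AddSubgroup M :=
  AddSubgroup.closure {m | ∃ s ∈ S, ∃ a : R, m = act s a}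

theorem act_mem_span {S : Set M} {s : M} (hs : s ∈ S) (a : R) : act s a ∈ span R S :=
  AddSubgroup.subset_closure ⟨s, hs, a, rfl⟩

theorem span_le {S : Set M} {N : AddSubgroup M} (h : ∀ s ∈ S, ∀ a : R, act s a ∈ N) :
    span R S ≤ N := by
  refine (AddSubgroup.closure_le _).2 ?_
  rintro _ ⟨s, hs, a, rfl⟩
  exact h s hs a

theorem act_mem_span_of_mem {S : Set M} {m : M} (hm : m ∈ span R S) (a : R) :
    act m a ∈ span R S := by
  have : span R S ≤ (span R S).comap ((act (R := R) (M := M)).flip a) := by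
    refine span_le fun s hs b => ?_
    simp only [AddSubgroup.mem_comap, AddMonoidHom.flip_apply]
    rw [← act_mul]
    exact act_mem_span hs _
  exact this hm

theorem span_mono {S T : Set M} (h : S ⊆ T) : span R S ≤ span R T :=
  span_le fun _ hs a => act_mem_span (h hs) a

theorem exists_finset_of_mem_span {S : Set M} {m : M} (hm : m ∈ span R S) :
    ∃ F : Finset M, (F : Set M) ⊆ S ∧ m ∈ span R (F : Set M) := by
  classical
  induction hm using AddSubgroup.closure_induction with
  | mem x hx =>
    obtain ⟨s, hs, a, rfl⟩ := hx
    exact ⟨{s}, by simpa using hs, act_mem_span (by simp) a⟩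
  | zero => exact ⟨∅, by simp, zero_mem _⟩
  | add x y _ _ hx hy =>
    obtain ⟨F, hF, hx⟩ := hx
    obtain ⟨G, hG, hy⟩ := hy
    refine ⟨F ∪ G, by simp [hF, hG], add_mem ?_ ?_⟩
    · exact span_mono (by simp) hx
    · exact span_mono (by simp) hy
  | neg x _ hx =>
    obtain ⟨F, hF, hx⟩ := hx
    exact ⟨F, hF, neg_mem hx⟩

theorem mem_span_insert {S : Set M} {x y : M} (h : x ∈ span R (insert y S)) :
    ∃ s ∈ span R S, ∃ a : R, x = s + act y a := by
  have : span R (insert y S) ≤ span R S ⊔ (act y : R →+ M).range := by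
    refine span_le fun s hs a => ?_
    rcases hs with rfl | hs
    · exact AddSubgroup.mem_sup_right ⟨a, rfl⟩
    · exact AddSubgroup.mem_sup_left (act_mem_span hs a)
  obtain ⟨s, hs, _, ⟨a, rfl⟩, rfl⟩ := AddSubgroup.mem_sup.1 (this h)
  exact ⟨s, hs, a, rfl⟩

end RightModule

/-! ### Homogeneous components of products. -/

namespace ModuleGrading

open RightModule

variable {Γ : Type v₁} [Groupoid.{v₂} Γ] {R : Type u} [NonUnitalRing R]
  {A : GroupoidGrading Γ R} {M : Type w} [AddCommGroup M] [RightModule R M]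
  (B : ModuleGrading A M)

theorem closure_act_eq_top : AddSubgroup.closure
      {y : M | ∃ α, ∃ m ∈ B.comp α, ∃ β, ∃ a ∈ A.comp β, y = act m a} = ⊤ := by
  rw [← B.unital]
  refine le_antisymm (AddSubgroup.closure_mono ?_) ((AddSubgroup.closure_le _).2 ?_)
  · rintro _ ⟨α, m, -, β, a, -, rfl⟩
    exact ⟨m, a, rfl⟩
  · rintro _ ⟨m, a, rfl⟩
    set K := AddSubgroup.closure
      {y : M | ∃ α, ∃ m ∈ B.comp α, ∃ β, ∃ a ∈ A.comp β, y = act m a}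
    have h1 : ∀ α, ∀ m ∈ B.comp α, ∀ a : R, act m a ∈ K := fun α m hm a => by
      have := A.internal.eq_top_of_forall_le (N := K.comap (act m : R →+ M))
        fun β a ha => AddSubgroup.subset_closure ⟨α, m, hm, β, a, ha, rfl⟩
      exact (this ▸ AddSubgroup.mem_top a : a ∈ K.comap (act m : R →+ M))
    have := B.internal.eq_top_of_forall_le (N := K.comap ((act (R := R) (M := M)).flip a))
      fun α m hm => h1 α m hm a
    exact (this ▸ AddSubgroup.mem_top m : m ∈ K.comap ((act (R := R) (M := M)).flip a))

/-- This is where `MR = M` is needed: `M` is generated by products of homogeneous elements, and on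
these the claim reduces to `a 1 = a` in `R`. Composing with the projection discards generators of
other degrees. -/
theorem act_one {γ : GrpdMor Γ} {m : M} (hm : m ∈ B.comp γ) : act m (A.one γ.d) = m := by
  have key : ((act (R := R) (M := M)).flip (A.one γ.d)).comp (B.internal.proj γ) =
      B.internal.proj γ := by
    refine AddMonoidHom.eq_of_eqOn_dense B.closure_act_eq_top ?_
    rintro _ ⟨⟨f, g, α⟩, m, hm, ⟨e, f', β⟩, a, ha, rfl⟩
    by_cases hf : f = f'
    · subst hf
      have hma := B.act_mem α β m a hm ha
      by_cases hγ : (⟨e, g, β ≫ α⟩ : GrpdMor Γ) = γ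
      · subst hγ
        simp only [AddMonoidHom.comp_apply, AddMonoidHom.flip_apply]
        rw [B.internal.proj_of_mem hma, ← act_mul]
        congr 1
        exact A.mul_one ⟨e, f, β⟩ a ha
      · simp [B.internal.proj_of_mem_ne hma hγ]
    · simp [B.act_eq_zero ⟨f, g, α⟩ ⟨e, f', β⟩ m a hf hm ha]
  have := DFunLike.congr_fun key m
  simpa [B.internal.proj_of_mem hm] using this

/-- Acting on `y` shifts degrees by `ε ↦ ε ≫ δ`, which is injective because `δ` can be cancelled, so
distinct components of `a` never mix. -/
theorem proj_act {e f g : Γ} (δ : f ⟶ g) (ε : e ⟶ f) {y : M} (hy : y ∈ B.comp ⟨f, g, δ⟩) (a : R) :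
    B.internal.proj ⟨e, g, ε ≫ δ⟩ (act y a) = act y (A.internal.proj ⟨e, f, ε⟩ a) := by
  have key : (B.internal.proj ⟨e, g, ε ≫ δ⟩).comp (act y : R →+ M) =
      (act y : R →+ M).comp (A.internal.proj ⟨e, f, ε⟩) := by
    refine A.internal.addMonoidHom_ext ?_
    rintro ⟨p, q, β⟩ a ha
    simp only [AddMonoidHom.comp_apply]
    by_cases hf : f = q
    · subst hf
      have hya := B.act_mem δ β y a hy ha
      by_cases hβ : (⟨p, f, β⟩ : GrpdMor Γ) = ⟨e, f, ε⟩
      · obtain rfl : p = e := congrArg (·.1) hβ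
        obtain rfl : β = ε := by simpa using hβ
        rw [B.internal.proj_of_mem hya, A.internal.proj_of_mem ha]
      · rw [A.internal.proj_of_mem_ne ha hβ, map_zero, B.internal.proj_of_mem_ne hya]
        intro h
        apply hβ
        obtain rfl : p = e := congrArg (·.1) h
        obtain rfl : β = ε := (cancel_mono δ).1 (by simpa using h)
        rfl
    · rw [B.act_eq_zero ⟨f, g, δ⟩ ⟨p, q, β⟩ y a hf hy ha, A.internal.proj_of_mem_ne ha, map_zero,
        map_zero]
      rintro h
      exact hf (congrArg (·.2.1) h).symm
  exact DFunLike.congr_fun key a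

theorem proj_act_of_ne {γ δ : GrpdMor Γ} (h : γ.r ≠ δ.r) {y : M} (hy : y ∈ B.comp δ) (a : R) :
    B.internal.proj γ (act y a) = 0 := by
  have key : (B.internal.proj γ).comp (act y : R →+ M) = 0 := by
    refine A.internal.addMonoidHom_ext ?_
    rintro ⟨p, q, β⟩ a ha
    obtain ⟨f, g, δ⟩ := δ
    simp only [AddMonoidHom.comp_apply, AddMonoidHom.zero_apply]
    by_cases hf : f = q
    · subst hf
      refine B.internal.proj_of_mem_ne (B.act_mem δ β y a hy ha) ?_
      rintro rfl
      exact h rfl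
    · rw [B.act_eq_zero ⟨f, g, δ⟩ ⟨p, q, β⟩ y a hf hy ha, map_zero]
  exact DFunLike.congr_fun key a

/-- The coefficient is the component of `a` in degree `γ ≫ δ⁻¹`, if this composite exists, and `0`
otherwise. Hence spans of homogeneous sets are graded. -/
theorem exists_proj_act_eq (γ : GrpdMor Γ) {δ : GrpdMor Γ} {y : M} (hy : y ∈ B.comp δ) (a : R) :
    ∃ β, ∃ b ∈ A.comp β, B.internal.proj γ (act y a) = act y b := by
  by_cases h : γ.r = δ.r
  · obtain ⟨e, g, γ⟩ := γ
    obtain ⟨f, g', δ⟩ := δ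
    obtain rfl : g = g' := h
    refine ⟨_, _, A.internal.proj_mem ⟨e, f, γ ≫ Groupoid.inv δ⟩ a, ?_⟩
    rw [← B.proj_act δ _ hy a]
    simp
  · exact ⟨γ, 0, zero_mem _, by rw [B.proj_act_of_ne h hy, map_zero]⟩

end ModuleGrading

namespace RightModule

variable (R : Type u) {M : Type w} [NonUnitalRing R] [AddCommGroup M] [RightModule R M]

/-- No element of `S` lies in the submodule generated by the others. -/
def SpanIndep (S : Set M) : Prop := ∀ s ∈ S, s ∉ span R (S \ {s})

end RightModule

theorem GroupoidGrading.proj_eq_zero_of_mem_oneMulIdeal {Γ : Type v₁} [Groupoid.{v₂} Γ]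
    {R : Type u} [NonUnitalRing R] (A : GroupoidGrading Γ R) {e : Γ} {ε : GrpdMor Γ} (h : ε.r ≠ e)
    {a : R} (ha : a ∈ A.oneMulIdeal e) : A.internal.proj ε a = 0 := by
  obtain ⟨a, rfl⟩ := ha
  have key : (A.internal.proj ε).comp (AddMonoidHom.mulLeft (A.one e)) = 0 := by
    refine A.internal.addMonoidHom_ext fun β a ha => ?_
    change A.internal.proj ε (A.one e * a) = 0
    by_cases hβ : e = β.r
    · subst hβ
      rw [A.one_mul β a ha]
      refine A.internal.proj_of_mem_ne ha ?_
      rintro rfl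
      exact h rfl
    · rw [A.mul_eq_zero (GrpdMor.idMor e) β _ a hβ (A.one_mem e) ha, map_zero]
  exact DFunLike.congr_fun key a

/-! ### Exchange and independence over a graded division ring. -/

namespace ModuleGrading

open RightModule

variable {Γ : Type v₁} [Groupoid.{v₂} Γ] {R : Type u} [NonUnitalRing R]
  {A : GroupoidGrading Γ R} {M : Type w} [AddCommGroup M] [RightModule R M]
  (B : ModuleGrading A M)

/-- All elements of `S` are homogeneous. -/
def HomogeneousSet (S : Set M) : Prop := ∀ s ∈ S, ∃ γ, s ∈ B.comp γ

variable {B} {S T : Set M}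

theorem HomogeneousSet.mono (hT : B.HomogeneousSet T) (h : S ⊆ T) : B.HomogeneousSet S :=
  fun s hs => hT s (h hs)

/-- Not automatic, since `span` contains only sums of multiples `s · a`; a homogeneous `s` equals `s
· 1_{d(γ)}`. -/
theorem HomogeneousSet.subset_span (hS : B.HomogeneousSet S) : S ⊆ span R S := by
  intro s hs
  obtain ⟨γ, hγ⟩ := hS s hs
  rw [← B.act_one hγ]
  exact act_mem_span hs _

theorem span_le_span (h : S ⊆ span R T) :
    span R S ≤ span R T :=
  span_le fun _ hs a => act_mem_span_of_mem (h hs) a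

theorem HomogeneousSet.proj_mem_span (hS : B.HomogeneousSet S) (γ : GrpdMor Γ) {m : M}
    (hm : m ∈ span R S) : B.internal.proj γ m ∈ span R S := by
  have : span R S ≤ (span R S).comap (B.internal.proj γ) := by
    refine span_le fun s hs a => ?_
    obtain ⟨δ, hδ⟩ := hS s hs
    obtain ⟨_, b, -, hb⟩ := B.exists_proj_act_eq γ hδ a
    rw [AddSubgroup.mem_comap, hb]
    exact act_mem_span hs b
  exact this hm

/-- The sole direct use of invertibility in the forward direction: multiply by a right inverse of
`b`. -/
theorem mem_span_of_act_mem_span (hA : A.IsGrDivisionRing) {δ β : GrpdMor Γ} {x : M} {b : R}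
    (hx : x ∈ B.comp δ) (hb : b ∈ A.comp β) (hb0 : b ≠ 0) (hβ : δ.d = β.r)
    (h : act x b ∈ span R S) : x ∈ span R S := by
  obtain ⟨c, -, hc, -⟩ := hA.2 β b hb hb0
  have := act_mem_span_of_mem h c
  rwa [← act_mul, hc, ← hβ, B.act_one hx] at this

theorem span_exchange (hA : A.IsGrDivisionRing) (hS : B.HomogeneousSet S) {γ δ : GrpdMor Γ}
    {x y : M} (hx : x ∈ B.comp γ) (hy : y ∈ B.comp δ) (h : x ∈ span R (insert y S))
    (hxS : x ∉ span R S) : y ∈ span R (insert x S) := by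
  obtain ⟨s, hs, a, hxs⟩ := mem_span_insert h
  obtain ⟨β, b, hb, hab⟩ := B.exists_proj_act_eq γ hy a
  have hx' : x = B.internal.proj γ s + act y b := by
    rw [← hab, ← map_add, ← hxs, B.internal.proj_of_mem hx]
  have hs' := hS.proj_mem_span γ hs
  have hyb : act y b ≠ 0 := fun h0 => hxS (by rw [hx', h0, add_zero]; exact hs')
  have hb0 : b ≠ 0 := fun h0 => hyb (by rw [h0, map_zero])
  -- The degrees of `y` and `b` must be composable, since otherwise `y · b = 0`.
  refine mem_span_of_act_mem_span hA hy hb hb0 ?_ ?_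
  · by_contra hne
    exact hyb (B.act_eq_zero δ β y b hne hy hb)
  · rw [eq_sub_of_add_eq' hx'.symm]
    refine sub_mem ?_ (span_mono (Set.subset_insert _ _) hs')
    have : B.HomogeneousSet {x} := by rintro _ rfl; exact ⟨γ, hx⟩
    exact span_mono (by simp) (this.subset_span rfl)

/-- Delete elements of `U` until `t` leaves the span; the element whose deletion causes this can be
exchanged with `t`. -/
theorem span_exchange_finset (hA : A.IsGrDivisionRing) [DecidableEq M] {K U : Finset M} {t : M}
    (hK : B.HomogeneousSet (K : Set M)) (hU : B.HomogeneousSet (U : Set M)) {γ : GrpdMor Γ}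
    (ht : t ∈ B.comp γ) (hKU : Disjoint K U) (htU : t ∈ span R ((K ∪ U : Finset M) : Set M))
    (htK : t ∉ span R (K : Set M)) :
    ∃ s ∈ U, s ∈ span R (insert t (((K ∪ U).erase s : Finset M) : Set M)) := by
  induction U using Finset.induction_on with
  | empty => simp at htU; exact absurd htU htK
  | insert u U hu ih =>
    rw [Finset.disjoint_insert_right] at hKU
    have hU' : B.HomogeneousSet (U : Set M) := hU.mono (by simp)
    by_cases h : t ∈ span R ((K ∪ U : Finset M) : Set M)
    · obtain ⟨s, hs, hs'⟩ := ih hU' hKU.2 h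
      refine ⟨s, Finset.mem_insert_of_mem hs, span_mono (Set.insert_subset_insert ?_) hs'⟩
      exact_mod_cast Finset.erase_subset_erase s
        (Finset.union_subset_union_right (Finset.subset_insert u U))
    · obtain ⟨δ, hδ⟩ := hU u (by simp)
      refine ⟨u, Finset.mem_insert_self _ _, ?_⟩
      have e : (K ∪ insert u U).erase u = K ∪ U := by
        ext m
        simp only [Finset.mem_erase, Finset.mem_union, Finset.mem_insert]
        constructor
        · tauto
        · intro hm
          refine ⟨?_, by tauto⟩
          rintro rfl
          tauto
      rw [e]
      refine span_exchange hA ?_ ht hδ ?_ h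
      · intro s hs
        simp only [Finset.coe_union, Set.mem_union] at hs
        exact hs.elim (hK s) (hU' s)
      · convert htU using 2
        simp

/-- Steinitz replacement: swapping some `s ∈ S \ T` for `t ∈ T \ S` preserves `S.card` and the
spanning property while `T \ S` shrinks, until `T ⊆ S`. -/
theorem card_le_card_of_spanIndep (hA : A.IsGrDivisionRing) {S T : Finset M}
    (hS : B.HomogeneousSet (S : Set M)) (hT : B.HomogeneousSet (T : Set M))
    (hTi : SpanIndep R (T : Set M)) (h : (T : Set M) ⊆ span R (S : Set M)) :
    T.card ≤ S.card := by
  classical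
  induction hn : (T \ S).card using Nat.strong_induction_on generalizing S with
  | _ n ih =>
  by_cases hTS : T ⊆ S
  · exact Finset.card_le_card hTS
  obtain ⟨t, htT, htS⟩ := Finset.not_subset.1 hTS
  obtain ⟨γ, hγ⟩ := hT t htT
  have hKU : S ∩ T ∪ S \ T = S := by rw [Finset.union_comm, Finset.sdiff_union_inter]
  -- Independence of `T` keeps `t` out of the span of `S ∩ T`, so the exchanged element can be found
  -- outside `T`.
  obtain ⟨s, hs, hs'⟩ := span_exchange_finset hA (K := S ∩ T) (U := S \ T) (t := t)
    (hS.mono (by simp)) (hS.mono (by simp)) hγ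
    (Finset.disjoint_sdiff_inter S T).symm (by rw [hKU]; exact h htT) (fun hmem => hTi t htT
      (span_mono (fun m hm => by
        simp only [Finset.coe_inter, Set.mem_inter_iff, Finset.mem_coe] at hm
        refine ⟨hm.2, ?_⟩
        rintro rfl
        exact htS hm.1) hmem))
  rw [hKU] at hs'
  obtain ⟨hsS, hsT⟩ := Finset.mem_sdiff.1 hs
  have hS1 : B.HomogeneousSet ((insert t (S.erase s) : Finset M) : Set M) := by
    intro m hm
    rcases Finset.mem_insert.1 hm with rfl | hm
    · exact ⟨γ, hγ⟩
    · exact hS m (Finset.mem_of_mem_erase hm)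
  have hcard : (insert t (S.erase s)).card = S.card := by
    rw [Finset.card_insert_of_notMem (fun hm => htS (Finset.mem_of_mem_erase hm)),
      Finset.card_erase_add_one hsS]
  rw [← hcard]
  refine ih _ ?_ hS1 ?_ rfl
  · rw [← hn]
    refine Finset.card_lt_card ⟨?_, ?_⟩
    · intro m hm
      simp only [Finset.mem_sdiff, Finset.mem_insert, Finset.mem_erase] at hm ⊢
      refine ⟨hm.1, fun hmS => hm.2 (Or.inr ⟨?_, hmS⟩)⟩
      rintro rfl
      exact hsT hm.1
    · intro hsub
      have := hsub (Finset.mem_sdiff.2 ⟨htT, htS⟩)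
      simp at this
  · refine h.trans (span_le_span ?_)
    intro m hm
    by_cases hms : m = s
    · subst hms
      simpa using hs'
    · exact hS1.subset_span (by simp [hms, Finset.mem_coe.1 hm])

/-- A dependence involves finitely many elements, so in the union of a chain it already occurs in
one member. -/
theorem exists_maximal_spanIndep (B : ModuleGrading A M) :
    ∃ S : Set M, Maximal (· ∈ {S : Set M | B.HomogeneousSet S ∧ SpanIndep R S}) S := by
  classical
  refine zorn_subset _ fun c hc hchain => ?_
  refine ⟨⋃₀ c, ⟨?_, ?_⟩, fun s hs => Set.subset_sUnion_of_mem hs⟩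
  · rintro s ⟨S, hS, hs⟩
    exact (hc hS).1 s hs
  · rintro s ⟨S, hS, hs⟩ hspan
    obtain ⟨F, hF, hsF⟩ := exists_finset_of_mem_span hspan
    obtain ⟨S', hS', hFS'⟩ := hchain.directedOn.exists_mem_subset_of_finite_of_subset_sUnion
      ⟨S, hS⟩ (insert s F).finite_toSet (by
        intro m hm
        rcases Finset.mem_insert.1 hm with rfl | hm
        · exact ⟨S, hS, hs⟩
        · exact (hF hm).1)
    refine (hc hS').2 s (hFS' (by simp)) (span_mono ?_ hsF)
    exact fun m hm => ⟨hFS' (by simp [Finset.mem_coe.1 hm]), (hF hm).2⟩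

theorem exists_spanIndep_span_eq_top (hA : A.IsGrDivisionRing) (B : ModuleGrading A M) :
    ∃ S : Set M, B.HomogeneousSet S ∧ SpanIndep R S ∧ span R S = ⊤ := by
  obtain ⟨S, hS, hmax⟩ := B.exists_maximal_spanIndep
  refine ⟨S, hS.1, hS.2, B.internal.eq_top_of_forall_le fun γ m hm => ?_⟩
  by_contra hmS
  refine hmS (hS.1.subset_span (hmax (y := insert m S) ⟨?_, ?_⟩ (Set.subset_insert m S)
    (Set.mem_insert m S)))
  · rintro s (rfl | hs)
    · exact ⟨γ, hm⟩
    · exact hS.1 s hs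
  · have hm' : m ∉ S := fun h => hmS (hS.1.subset_span h)
    rintro s (rfl | hs) hspan
    · exact hmS (span_mono (by simp) hspan)
    -- If `m` made an old `s` dependent, exchanging `s` with `m` would put `m` in the span of `S`.
    · have hne : m ≠ s := fun h => hm' (h ▸ hs)
      obtain ⟨δ, hδ⟩ := hS.1 s hs
      rw [← Set.insert_sdiff_singleton_comm hne] at hspan
      have := span_exchange hA (hS.1.mono Set.sdiff_subset) hδ hm hspan (hS.2 s hs)
      rw [Set.insert_sdiff_singleton, Set.insert_eq_of_mem hs] at this
      exact hmS this

theorem generates_iff (hS : B.HomogeneousSet S) : Generates R S ↔ span R S = ⊤ := by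
  constructor
  · intro h
    exact h _ (fun m hm a => act_mem_span_of_mem hm a) hS.subset_span
  · intro h N hN hSN
    rw [eq_top_iff, ← h]
    exact span_le fun s hs a => hN s (hSN hs) a

/-! ### Pseudo-bases versus independent spanning families. -/

section Families

variable {I : Type*} {γ : I → GrpdMor Γ} {x : I → M}

/-- A nonzero `a j` has a nonzero component, whose target is `d(γ j)` because `a j ∈ 1_{d(γ j)}R`.
Projecting the relation to the matching degree and inverting this component puts `x j` in the span
of the others. -/
theorem eq_zero_of_sum_act_eq_zero (hA : A.IsGrDivisionRing) (hx : ∀ i, x i ∈ B.comp (γ i))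
    (hi : ∀ i, x i ∉ span R (x '' {i}ᶜ)) (a : I →₀ R) (ha : ∀ i, a i ∈ A.oneMulIdeal (γ i).d)
    (hsum : (a.sum fun i r => act (x i) r) = 0) : a = 0 := by
  classical
  by_contra ha0
  obtain ⟨j, hj⟩ := Finsupp.ne_iff.1 ha0
  obtain ⟨ε, hε⟩ : ∃ ε, A.internal.proj ε (a j) ≠ 0 := by
    by_contra! h
    exact hj (A.internal.eq_zero_of_forall_proj h)
  have hr : (γ j).d = ε.r := by
    by_contra hne
    exact hε (A.proj_eq_zero_of_mem_oneMulIdeal (Ne.symm hne) (ha j))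
  have hhom : B.HomogeneousSet (x '' {j}ᶜ) := by
    rintro _ ⟨i, -, rfl⟩
    exact ⟨_, hx i⟩
  have hmem : act (x j) (a j) ∈ span R (x '' {j}ᶜ) := by
    rw [Finsupp.sum, ← Finset.add_sum_erase _ _ (Finsupp.mem_support_iff.2 hj)] at hsum
    rw [eq_neg_of_add_eq_zero_left hsum]
    refine neg_mem (sum_mem fun i hi => act_mem_span (Set.mem_image_of_mem x ?_) _)
    simpa using Finset.ne_of_mem_erase hi
  refine hi j (mem_span_of_act_mem_span hA (hx j) (A.internal.proj_mem ε (a j)) hε hr ?_)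
  have hxj := hx j
  generalize γ j = δ at hr hxj
  obtain ⟨f, g, δ⟩ := δ
  obtain ⟨e, f', ε⟩ := ε
  obtain rfl : f = f' := hr
  rw [← B.proj_act δ ε hxj]
  exact hhom.proj_mem_span _ hmem

theorem isPseudoFree_of_isGrDivisionRing (hA : A.IsGrDivisionRing) (B : ModuleGrading A M) :
    B.IsPseudoFree := by
  obtain ⟨S, hS, hSi, hspan⟩ := exists_spanIndep_span_eq_top hA B
  choose γ hγ using hS
  refine ⟨S, fun s => γ s s.2, Subtype.val, ⟨fun s => hγ s s.2, ?_, ?_⟩⟩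
  · refine eq_zero_of_sum_act_eq_zero (γ := fun s : S => γ s s.2) hA (fun s => hγ s s.2) fun s hs =>
      hSi s s.2 ?_
    convert hs using 2
    ext m
    simp [and_comm]
  · rw [Subtype.range_coe]
    exact (generates_iff (B := B) fun s hs => ⟨_, hγ s hs⟩).2 hspan

namespace IsPseudoBasis

theorem homogeneousSet (h : B.IsPseudoBasis γ x) : B.HomogeneousSet (Set.range x) := by
  rintro _ ⟨i, rfl⟩
  exact ⟨_, h.mem i⟩

theorem exists_finsupp (h : B.IsPseudoBasis γ x) {T : Set I} {m : M} (hm : m ∈ span R (x '' T)) :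
    ∃ a : I →₀ R, (∀ i ∉ T, a i = 0) ∧ (∀ i, a i ∈ A.oneMulIdeal (γ i).d) ∧
      (a.sum fun i r => act (x i) r) = m := by
  classical
  induction hm using AddSubgroup.closure_induction with
  | mem m hm =>
    obtain ⟨_, ⟨i, hi, rfl⟩, a, rfl⟩ := hm
    -- Multiplying by `1_{d(γ i)}` puts the coefficient in the required right ideal without changing
    -- `x i · a`.
    refine ⟨Finsupp.single i (A.one (γ i).d * a), fun j hj => ?_, fun j => ?_, ?_⟩
    · exact Finsupp.single_eq_of_ne (by rintro rfl; exact hj hi)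
    · by_cases hij : j = i
      · subst hij
        simp [GroupoidGrading.oneMulIdeal]
      · rw [Finsupp.single_eq_of_ne hij]
        exact zero_mem _
    · rw [Finsupp.sum_single_index (by simp), act_mul, B.act_one (h.mem i)]
  | zero => exact ⟨0, by simp, fun i => zero_mem _, by simp⟩
  | add m m' _ _ hm hm' =>
    obtain ⟨a, h1, h2, rfl⟩ := hm
    obtain ⟨b, h3, h4, rfl⟩ := hm'
    refine ⟨a + b, fun i hi => by simp [h1 i hi, h3 i hi], fun i => add_mem (h2 i) (h4 i), ?_⟩
    exact Finsupp.sum_add_index' (fun _ => map_zero _) fun _ => map_add _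
  | neg m _ hm =>
    obtain ⟨a, h1, h2, rfl⟩ := hm
    refine ⟨-a, fun i hi => by simp [h1 i hi], fun i => neg_mem (h2 i), ?_⟩
    rw [Finsupp.sum_neg_index (fun _ => map_zero _)]
    simp [Finsupp.sum]

/-- Otherwise subtracting `x i · 1_{d(γ i)}` gives a relation with coefficient `-1_{d(γ i)} ≠ 0` at
`i`. -/
theorem notMem_span (h : B.IsPseudoBasis γ x) {i : I} (hi : A.one (γ i).d ≠ 0) :
    x i ∉ span R (x '' {i}ᶜ) := by
  classical
  intro hmem
  obtain ⟨a, h1, h2, h3⟩ := h.exists_finsupp hmem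
  have hone : A.one (γ i).d ∈ A.oneMulIdeal (γ i).d :=
    ⟨A.one (γ i).d, A.one_mul (GrpdMor.idMor _) _ (A.one_mem _)⟩
  have key := h.indep (a - Finsupp.single i (A.one (γ i).d)) (fun j => ?_) ?_
  · have := DFunLike.congr_fun key i
    simp [h1 i (by simp)] at this
    exact hi this
  · refine sub_mem (h2 j) ?_
    by_cases hij : j = i
    · subst hij
      simpa using hone
    · rw [Finsupp.single_eq_of_ne hij]
      exact zero_mem _
  · rw [Finsupp.sum_sub_index (fun _ => map_sub _), h3, Finsupp.sum_single_index (by simp),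
      B.act_one (h.mem i), sub_self]

theorem injective (h : B.IsPseudoBasis γ x) (hone : ∀ i, A.one (γ i).d ≠ 0) :
    Function.Injective x := by
  intro i j hij
  by_contra hne
  refine h.notMem_span (hone i) ((h.homogeneousSet.mono (Set.image_subset_range _ _)).subset_span ?_)
  exact ⟨j, fun h => hne h.symm, hij.symm⟩

theorem spanIndep (h : B.IsPseudoBasis γ x) (hone : ∀ i, A.one (γ i).d ≠ 0) :
    SpanIndep R (Set.range x) := by
  rintro _ ⟨i, rfl⟩ hmem
  refine h.notMem_span (hone i) (span_mono ?_ hmem)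
  rintro _ ⟨⟨j, rfl⟩, hj⟩
  exact ⟨j, fun hji => hj (by rw [hji]; rfl), rfl⟩

theorem span_eq_top (h : B.IsPseudoBasis γ x) : span R (Set.range x) = ⊤ :=
  (generates_iff h.homogeneousSet).1 h.generates

/-- Finitely many generators involve only finitely many `x i`; these already span, so independence
leaves no room for another. -/
theorem finite_range (h : B.IsPseudoBasis γ x) (hone : ∀ i, A.one (γ i).d ≠ 0)
    (hfg : IsFG R M) : (Set.range x).Finite := by
  classical
  obtain ⟨G, hG, hgen⟩ := hfg
  have : ∀ m : M, ∃ F : Finset M, (F : Set M) ⊆ Set.range x ∧ m ∈ span R (F : Set M) := fun m =>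
    exists_finset_of_mem_span (by rw [h.span_eq_top]; trivial)
  choose F hF hmF using this
  have htop : span R ((hG.toFinset.biUnion F : Finset M) : Set M) = ⊤ := by
    refine hgen _ (fun m hm a => act_mem_span_of_mem hm a) fun m hm => span_mono ?_ (hmF m)
    exact_mod_cast Finset.subset_biUnion_of_mem F (hG.mem_toFinset.2 hm)
  refine (hG.toFinset.biUnion F).finite_toSet.subset ?_
  intro m hm
  by_contra hmF'
  refine h.spanIndep hone m hm (span_mono ?_ (htop ▸ AddSubgroup.mem_top m :
    m ∈ span R ((hG.toFinset.biUnion F : Finset M) : Set M)))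
  intro s hs
  refine ⟨?_, ?_⟩
  · obtain ⟨g, -, hg⟩ := Finset.mem_biUnion.1 hs
    exact hF g hg
  · rintro rfl
    exact hmF' hs

theorem card_le_card (hA : A.IsGrDivisionRing) {J : Type*} {δ : J → GrpdMor Γ} {y : J → M}
    (hx : B.IsPseudoBasis γ x) (hy : B.IsPseudoBasis δ y) (hxone : ∀ i, A.one (γ i).d ≠ 0)
    (hxfin : (Set.range x).Finite) (hyfin : (Set.range y).Finite) :
    hxfin.toFinset.card ≤ hyfin.toFinset.card := by
  refine card_le_card_of_spanIndep (B := B) hA ?_ ?_ ?_ ?_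
  · simpa using hy.homogeneousSet
  · simpa using hx.homogeneousSet
  · simpa using hx.spanIndep hxone
  · simp [hy.span_eq_top]

end IsPseudoBasis

end Families

theorem mk_eq_mk_of_isGrDivisionRing (hA : A.IsGrDivisionRing) (hfg : IsFG R M) {I J : Type w}
    {γ : I → GrpdMor Γ} {x : I → M} {δ : J → GrpdMor Γ} {y : J → M}
    (hx : B.IsPseudoBasis γ x) (hy : B.IsPseudoBasis δ y) (hxone : ∀ i, A.one (γ i).d ≠ 0)
    (hyone : ∀ j, A.one (δ j).d ≠ 0) : Cardinal.mk I = Cardinal.mk J := by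
  have hxfin := hx.finite_range hxone hfg
  have hyfin := hy.finite_range hyone hfg
  have h := le_antisymm (hx.card_le_card hA hy hxone hxfin hyfin)
    (hy.card_le_card hA hx hyone hyfin hxfin)
  rw [← Cardinal.mk_range_eq x (hx.injective hxone), ← Cardinal.mk_range_eq y (hy.injective hyone),
    ← hxfin.coe_toFinset, ← hyfin.coe_toFinset]
  exact Cardinal.mk_coe_finset.trans ((congrArg Nat.cast h).trans Cardinal.mk_coe_finset.symm)

end ModuleGrading

/-! ### Regular module, graded submodules and quotients. -/

open RightModule

/-- The right regular module, lifted to a larger universe. -/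
instance RightModule.ulift (R : Type u) [NonUnitalRing R] : RightModule R (ULift.{w} R) where
  act := (AddMonoidHom.compHom AddEquiv.ulift.symm.toAddMonoidHom).comp
    (AddMonoidHom.mul.comp AddEquiv.ulift.toAddMonoidHom)
  act_mul m a b := congrArg ULift.up (mul_assoc m.down a b).symm

/-- The grading of the right regular module. -/
def GroupoidGrading.ulift {Γ : Type v₁} [Groupoid.{v₂} Γ] {R : Type u} [NonUnitalRing R]
    (A : GroupoidGrading Γ R) : ModuleGrading A (ULift.{w} R) where
  comp γ := (A.comp γ).comap (AddEquiv.ulift : ULift.{w} R ≃+ R).toAddMonoidHom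
  internal := .of_proj
    (fun γ => AddEquiv.ulift.symm.toAddMonoidHom.comp
      ((A.internal.proj γ).comp AddEquiv.ulift.toAddMonoidHom))
    (fun γ m hm => congrArg ULift.up (A.internal.proj_of_mem hm))
    (fun γ δ m hm h => congrArg ULift.up (A.internal.proj_of_mem_ne hm h))
    (fun N hN => by
      have := A.internal.eq_top_of_forall_le (N := N.comap AddEquiv.ulift.symm.toAddMonoidHom)
        fun γ a ha => hN γ (show ULift.up a ∈ _ from ha)
      rw [eq_top_iff]
      intro m _
      exact (this ▸ AddSubgroup.mem_top m.down :
        m.down ∈ N.comap AddEquiv.ulift.symm.toAddMonoidHom))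
  act_mem γ δ m a hm ha := A.mul_mem γ δ m.down a hm ha
  act_eq_zero γ δ m a h hm ha := congrArg ULift.up (A.mul_eq_zero γ δ m.down a h hm ha)
  unital := by
    rw [eq_top_iff]
    intro m _
    have := A.internal.eq_top_of_forall_le (N := (AddSubgroup.closure
      {y : ULift.{w} R | ∃ (m : ULift.{w} R) (a : R), y = act m a}).comap
        AddEquiv.ulift.symm.toAddMonoidHom) fun γ a ha => AddSubgroup.subset_closure
          ⟨ULift.up a, A.one γ.d, congrArg ULift.up (A.mul_one γ a ha).symm⟩
    exact (this ▸ AddSubgroup.mem_top m.down : m.down ∈ (AddSubgroup.closure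
      {y : ULift.{w} R | ∃ (m : ULift.{w} R) (a : R), y = act m a}).comap
        AddEquiv.ulift.symm.toAddMonoidHom)

variable {Γ : Type v₁} [Groupoid.{v₂} Γ] {R : Type u} [NonUnitalRing R]
  {A : GroupoidGrading Γ R} {M : Type w} [AddCommGroup M] [RightModule R M]

/-- A graded submodule of a graded right module. -/
structure GradedSubmodule (B : ModuleGrading A M) extends AddSubgroup M where
  act_mem : ∀ m ∈ toAddSubgroup, ∀ a : R, act m a ∈ toAddSubgroup
  proj_mem : ∀ γ, ∀ m ∈ toAddSubgroup, B.internal.proj γ m ∈ toAddSubgroup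

namespace GradedSubmodule

variable {B : ModuleGrading A M} (N : GradedSubmodule B)

instance : RightModule R N.toAddSubgroup where
  act := AddMonoidHom.mk' (fun n => (act (n : M)).codRestrict N.toAddSubgroup (N.act_mem n n.2))
    fun m n => by ext; simp
  act_mul n a b := Subtype.ext (act_mul (n : M) a b)

instance : RightModule R (M ⧸ N.toAddSubgroup) where
  act := QuotientAddGroup.lift N.toAddSubgroup
    ((AddMonoidHom.compHom (QuotientAddGroup.mk' N.toAddSubgroup)).comp act) fun m hm => by
      ext a
      exact (QuotientAddGroup.eq_zero_iff _).2 (N.act_mem m hm a)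
  act_mul q a b := by
    obtain ⟨m, rfl⟩ := QuotientAddGroup.mk_surjective q
    exact congrArg QuotientAddGroup.mk (act_mul m a b)

/-- The induced grading of a graded submodule. -/
def grading : ModuleGrading A N.toAddSubgroup :=
  have htop : ∀ K : AddSubgroup N.toAddSubgroup,
      (∀ γ, (B.comp γ).addSubgroupOf N.toAddSubgroup ≤ K) → K = ⊤ := fun K hK => by
    rw [eq_top_iff]
    intro n _
    have : (n : M) ∈ K.map N.toAddSubgroup.subtype :=
      B.internal.mem_of_forall_proj_mem fun γ =>
        ⟨⟨_, N.proj_mem γ n n.2⟩, hK γ (B.internal.proj_mem γ _), rfl⟩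
    obtain ⟨k, hk, hkn⟩ := this
    obtain rfl : k = n := Subtype.ext hkn
    exact hk
  { comp γ := (B.comp γ).addSubgroupOf N.toAddSubgroup
    internal := .of_proj
      (fun γ => ((B.internal.proj γ).comp N.toAddSubgroup.subtype).codRestrict N.toAddSubgroup
        fun n => N.proj_mem γ n n.2)
      (fun γ m hm => Subtype.ext (B.internal.proj_of_mem hm))
      (fun γ δ m hm h => Subtype.ext (B.internal.proj_of_mem_ne hm h)) htop
    act_mem γ δ m a hm ha := B.act_mem γ δ (m : M) a hm ha
    act_eq_zero γ δ m a h hm ha := Subtype.ext (B.act_eq_zero γ δ (m : M) a h hm ha)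
    unital := htop _ fun γ m hm => AddSubgroup.subset_closure
      ⟨m, A.one γ.d, Subtype.ext (B.act_one hm).symm⟩ }

/-- The induced grading of the quotient by a graded submodule. -/
def quotientGrading : ModuleGrading A (M ⧸ N.toAddSubgroup) :=
  have htop : ∀ K : AddSubgroup (M ⧸ N.toAddSubgroup),
      (∀ γ, (B.comp γ).map (QuotientAddGroup.mk' N.toAddSubgroup) ≤ K) → K = ⊤ := fun K hK => by
    have := B.internal.eq_top_of_forall_le (N := K.comap (QuotientAddGroup.mk' N.toAddSubgroup))
      fun γ m hm => hK γ ⟨m, hm, rfl⟩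
    rw [eq_top_iff]
    intro q _
    obtain ⟨m, rfl⟩ := QuotientAddGroup.mk_surjective q
    exact (this ▸ AddSubgroup.mem_top m : m ∈ K.comap (QuotientAddGroup.mk' N.toAddSubgroup))
  { comp γ := (B.comp γ).map (QuotientAddGroup.mk' N.toAddSubgroup)
    internal := .of_proj
      (fun γ => QuotientAddGroup.map N.toAddSubgroup N.toAddSubgroup (B.internal.proj γ)
        fun m hm => N.proj_mem γ m hm)
      (by
        rintro γ _ ⟨m, hm, rfl⟩
        exact congrArg QuotientAddGroup.mk (B.internal.proj_of_mem hm))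
      (by
        rintro γ δ _ ⟨m, hm, rfl⟩ h
        exact congrArg QuotientAddGroup.mk (B.internal.proj_of_mem_ne hm h)) htop
    act_mem := by
      rintro e f g γ δ _ a ⟨m, hm, rfl⟩ ha
      exact ⟨_, B.act_mem γ δ m a hm ha, rfl⟩
    act_eq_zero := by
      rintro γ δ _ a h ⟨m, hm, rfl⟩ ha
      exact congrArg QuotientAddGroup.mk (B.act_eq_zero γ δ m a h hm ha)
    unital := htop _ (by
      rintro γ _ ⟨m, hm, rfl⟩
      exact AddSubgroup.subset_closure
        ⟨QuotientAddGroup.mk m, A.one γ.d, congrArg QuotientAddGroup.mk (B.act_one hm).symm⟩) }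

/-- The submodule `xR` generated by a homogeneous element `x`. -/
def cyclic (B : ModuleGrading A M) {γ : GrpdMor Γ} {x : M} (hx : x ∈ B.comp γ) :
    GradedSubmodule B where
  toAddSubgroup := (act x : R →+ M).range
  act_mem := by
    rintro _ ⟨b, rfl⟩ a
    exact ⟨b * a, act_mul x b a⟩
  proj_mem := by
    rintro δ _ ⟨b, rfl⟩
    obtain ⟨_, c, -, hc⟩ := B.exists_proj_act_eq δ hx b
    exact ⟨c, hc.symm⟩

theorem mem_cyclic_self {γ : GrpdMor Γ} {x : M} (hx : x ∈ B.comp γ) :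
    x ∈ (cyclic B hx).toAddSubgroup :=
  ⟨A.one γ.d, B.act_one hx⟩

theorem isPseudoBasis_cyclic {γ : GrpdMor Γ} {x : M} (hx : x ∈ B.comp γ)
    (h : ∀ a ∈ A.oneMulIdeal γ.d, act x a = 0 → a = 0) :
    (cyclic B hx).grading.IsPseudoBasis (fun _ : PUnit => γ)
      (fun _ => ⟨x, mem_cyclic_self hx⟩) where
  mem _ := hx
  indep a ha hsum := by
    ext
    refine h _ (ha _) ?_
    rw [Finsupp.sum_fintype _ _ (by simp), Fintype.sum_unique] at hsum
    exact congrArg Subtype.val hsum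
  generates := by
    intro K hK hxK
    rw [eq_top_iff]
    rintro ⟨_, a, rfl⟩ -
    exact hK _ (hxK ⟨PUnit.unit, rfl⟩) a

end GradedSubmodule

/-! ### Gluing pseudo-bases, and the converse. -/

namespace ModuleGrading.IsPseudoBasis

open GradedSubmodule

variable {B : ModuleGrading A M} {I : Type*} {γ : I → GrpdMor Γ} {x : I → M}

theorem eq_zero_of_one_eq_zero (h : B.IsPseudoBasis γ x) {i : I} (hi : A.one (γ i).d = 0) :
    x i = 0 := by
  rw [← B.act_one (h.mem i), hi, map_zero]

theorem exists_one_ne_zero [Nontrivial M] (h : B.IsPseudoBasis γ x) :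
    ∃ i, A.one (γ i).d ≠ 0 := by
  by_contra! h0
  refine bot_ne_top (h.generates ⊥ (by simp) ?_)
  rintro _ ⟨i, rfl⟩
  exact h.eq_zero_of_one_eq_zero (h0 i)

/-- The discarded `x i` are zero. This reduction is needed because IPBN compares only pseudo-bases
whose `1_{d(γ i)}` are nonzero. -/
theorem subtype (h : B.IsPseudoBasis γ x) :
    B.IsPseudoBasis (fun i : {i // A.one (γ i).d ≠ 0} => γ i) (fun i => x i) where
  mem i := h.mem i
  indep a ha hsum := by
    classical
    have key := h.indep (a.embDomain (Function.Embedding.subtype _)) (fun i => ?_) ?_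
    · exact (Finsupp.embDomain_eq_zero (f := Function.Embedding.subtype _)).1 key
    · by_cases hi : A.one (γ i).d ≠ 0
      · have := Finsupp.embDomain_apply_self (Function.Embedding.subtype _) a ⟨i, hi⟩
        simp only [Function.Embedding.subtype_apply] at this
        rw [this]
        exact ha ⟨i, hi⟩
      · rw [Finsupp.embDomain_of_notMem_range]
        · exact zero_mem _
        · rintro ⟨j, rfl⟩
          exact hi j.2
    · rw [Finsupp.sum_embDomain]
      exact hsum
  generates := by
    intro K hK hxK
    refine h.generates K hK ?_
    rintro _ ⟨i, rfl⟩
    by_cases hi : A.one (γ i).d = 0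
    · rw [h.eq_zero_of_one_eq_zero hi]
      exact zero_mem _
    · exact hxK ⟨⟨i, hi⟩, rfl⟩

/-- A pseudo-basis of a graded submodule and one of the quotient combine to a pseudo-basis. -/
theorem exists_sum {J : Type*} {δ : J → GrpdMor Γ} {N : GradedSubmodule B}
    {x : I → N.toAddSubgroup} {y : J → M ⧸ N.toAddSubgroup} (hx : N.grading.IsPseudoBasis γ x)
    (hy : N.quotientGrading.IsPseudoBasis δ y) :
    ∃ z : I ⊕ J → M, B.IsPseudoBasis (Sum.elim γ δ) z := by
  -- Each `y j` lifts to a homogeneous element of the same degree.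
  choose z hz hzy using hy.mem
  refine ⟨Sum.elim (fun i => (x i : M)) z, ?_, ?_, ?_⟩
  · rintro (i | j)
    · exact hx.mem i
    · exact hz j
  · intro a ha hsum
    obtain ⟨⟨b, c⟩, rfl⟩ := Finsupp.sumFinsuppEquivProdFinsupp.symm.surjective a
    change (Finsupp.sumElim b c).sum _ = 0 at hsum
    rw [Finsupp.sum_sumElim] at hsum
    -- Modulo `N` the terms from `x` vanish, leaving a relation among the `y j` alone.
    have hc : c = 0 := by
      refine hy.indep c (fun j => ha (Sum.inr j)) ?_
      have hmem : (b.sum fun i r => act (x i : M) r) ∈ N.toAddSubgroup :=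
        sum_mem fun i _ => N.act_mem _ (x i).2 _
      have hmap := congrArg (QuotientAddGroup.mk' N.toAddSubgroup) hsum
      rw [map_add, map_zero] at hmap
      refine Eq.trans ?_ (((zero_add _).symm.trans (congrArg (· + _)
        ((QuotientAddGroup.eq_zero_iff _).2 hmem).symm)).trans hmap)
      rw [map_finsuppSum]
      refine Finsupp.sum_congr fun j _ => ?_
      rw [← hzy j]
      rfl
    subst hc
    have hb : b = 0 := by
      refine hx.indep b (fun j => ha (Sum.inl j)) (Subtype.ext ?_)
      rw [Finsupp.sum_zero_index, add_zero] at hsum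
      exact (map_finsuppSum N.toAddSubgroup.subtype b _).trans hsum
    subst hb
    ext (i | j) <;> rfl
  · intro K hK hzK
    have hNK : N.toAddSubgroup ≤ K := by
      have := hx.generates (K.addSubgroupOf N.toAddSubgroup) (fun n hn a => hK n hn a) (by
        rintro _ ⟨i, rfl⟩
        exact hzK ⟨Sum.inl i, rfl⟩)
      simpa [AddSubgroup.addSubgroupOf_eq_top] using this
    have := hy.generates (K.map (QuotientAddGroup.mk' N.toAddSubgroup)) (by
        rintro _ ⟨k, hk, rfl⟩ a
        exact ⟨_, hK k hk a, rfl⟩) (by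
        rintro _ ⟨j, rfl⟩
        exact ⟨z j, hzK ⟨Sum.inr j, rfl⟩, hzy j⟩)
    rw [eq_top_iff]
    intro m _
    obtain ⟨k, hk, hkm⟩ := (this ▸ AddSubgroup.mem_top (m : M ⧸ N.toAddSubgroup) :
      (m : M ⧸ N.toAddSubgroup) ∈ K.map (QuotientAddGroup.mk' N.toAddSubgroup))
    have : -k + m ∈ K := hNK (QuotientAddGroup.eq.1 hkm)
    simpa using add_mem hk this

end ModuleGrading.IsPseudoBasis

theorem GroupoidGrading.exists_mul_eq_one (hpfm : GroupoidGrading.IsPfm.{u, v₁, v₂, w} A)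
    (hipbn : GroupoidGrading.HasIPBN.{u, v₁, v₂, w} A) {γ : GrpdMor Γ} {a : R}
    (ha : a ∈ A.comp γ) (ha0 : a ≠ 0) : ∃ b ∈ A.comp γ.inv, a * b = A.one γ.r := by
  classical
  let B : ModuleGrading A (ULift.{w} R) := A.ulift
  have hx : ULift.up (A.one γ.r) ∈ B.comp (GrpdMor.idMor γ.r) := A.one_mem _
  have hidem : A.one γ.r * A.one γ.r = A.one γ.r := A.one_mul (GrpdMor.idMor _) _ (A.one_mem _)
  have hr0 : A.one γ.r ≠ 0 := fun h => ha0 (by rw [← A.one_mul γ a ha, h, zero_mul])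
  let P := GradedSubmodule.cyclic B hx
  have haP : ULift.up a ∈ P.toAddSubgroup := ⟨a, congrArg ULift.up (A.one_mul γ a ha)⟩
  have ha' : (⟨_, haP⟩ : P.toAddSubgroup) ∈ P.grading.comp γ := ha
  have hP := GradedSubmodule.isPseudoBasis_cyclic hx (by
    rintro _ ⟨c, rfl⟩ hc
    have hc : A.one γ.r * (A.one γ.r * c) = 0 := congrArg ULift.down hc
    rwa [← mul_assoc, hidem] at hc)
  let N := GradedSubmodule.cyclic P.grading ha'
  by_cases htop : N.toAddSubgroup = ⊤
  · have : (⟨_, GradedSubmodule.mem_cyclic_self hx⟩ : P.toAddSubgroup) ∈ N.toAddSubgroup := by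
      rw [htop]; trivial
    obtain ⟨b, hb⟩ := this
    have hb : act (ULift.up.{w} a) b = ULift.up (A.one γ.r) := congrArg Subtype.val hb
    -- The right inverse `b` need not be homogeneous; the identity-degree component of `a b =
    -- 1_{r(γ)}` shows that its component in degree `γ⁻¹` is also a right inverse.
    have := B.proj_act γ.2.2 (Groupoid.inv γ.2.2) (y := ULift.up a) ha b
    rw [hb, Groupoid.inv_comp, B.internal.proj_of_mem hx] at this
    exact ⟨_, A.internal.proj_mem _ _, (congrArg ULift.down this).symm⟩
  · exfalso
    have : Nontrivial N.toAddSubgroup := by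
      refine ⟨⟨⟨_, GradedSubmodule.mem_cyclic_self ha'⟩, 0, fun h => ha0 ?_⟩⟩
      exact congrArg (fun n : N.toAddSubgroup => n.1.1.down) h
    have : Nontrivial (P.toAddSubgroup ⧸ N.toAddSubgroup) :=
      (QuotientAddGroup.nontrivial_iff).2 htop
    obtain ⟨I, α, x, hI⟩ := hpfm N.toAddSubgroup N.grading
    obtain ⟨J, β, y, hJ⟩ := hpfm (P.toAddSubgroup ⧸ N.toAddSubgroup) N.quotientGrading
    obtain ⟨z, hz⟩ := hI.exists_sum hJ
    obtain ⟨i, hi⟩ := hI.exists_one_ne_zero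
    obtain ⟨j, hj⟩ := hJ.exists_one_ne_zero
    -- Both `N` and `P/N` contribute a nontrivial index, while `P` has a one-element pseudo-basis.
    have hcard := hipbn P.toAddSubgroup P.grading
      ⟨_, Set.finite_range _, hP.generates⟩ _ PUnit _ _ _ _ hz.subtype hP (fun k => k.2)
      (fun _ => hr0)
    rw [Cardinal.mk_punit, Cardinal.eq_one_iff_unique] at hcard
    exact Sum.inl_ne_inr (congrArg Subtype.val (hcard.1.elim ⟨Sum.inl i, hi⟩ ⟨Sum.inr j, hj⟩))

theorem mainTheorem7 {Γ : Type v₁} [Groupoid.{v₂} Γ] {R : Type u} [NonUnitalRing R] [Nontrivial R]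
    (A : GroupoidGrading Γ R) :
    A.IsGrDivisionRing ↔ GroupoidGrading.IsPfm.{u, v₁, v₂, w} A ∧
      GroupoidGrading.HasIPBN.{u, v₁, v₂, w} A := by
  constructor
  · intro hA
    exact ⟨fun M _ _ B => ModuleGrading.isPseudoFree_of_isGrDivisionRing hA B,
      fun M _ _ B hfg I J γ x δ y hx hy hxone hyone =>
        ModuleGrading.mk_eq_mk_of_isGrDivisionRing hA hfg hx hy hxone hyone⟩
  · rintro ⟨hpfm, hipbn⟩
    refine ⟨inferInstance, fun γ a ha ha0 => ?_⟩
    have hr0 : A.one γ.r ≠ 0 := fun h => ha0 (by rw [← A.one_mul γ a ha, h, zero_mul])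
    obtain ⟨b, hb, hab⟩ := A.exists_mul_eq_one hpfm hipbn ha ha0
    have hb0 : b ≠ 0 := by
      rintro rfl
      exact hr0 (by rw [← hab, mul_zero])
    obtain ⟨c, hc, hbc⟩ := A.exists_mul_eq_one hpfm hipbn hb hb0
    -- With `a b = 1_{r(γ)}` and `b c = 1_{d(γ)}`, one has `a = a(bc) = (ab)c = c`.
    have hac : a = c := by
      rw [← A.mul_one γ a ha]
      change b * c = A.one γ.d at hbc
      rw [← hbc, ← mul_assoc, hab]
      have := A.one_mul γ.inv.inv c hc
      exact this
    exact ⟨b, hb, hab, by rw [hac]; exact hbc⟩
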